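/- Let $G$ be a finite nilpotent group. The enhanced power graph $\mathcal{G}_E(G)$ has vertex set $G$, and two distinct elements $x, y$ are adjacent if and only if there is $w \in G$ with $x, y \in \langle w\rangle$. The proper enhanced power graph $\mathcal{G}_E^{**}(G)$ is obtained from $\mathcal{G}_E(G)$ by deleting all dominating vertices, i.e. all vertices that are adjacent to every other vertex. A total (or strong) dominating set of a graph is a set $D$ of vertices such that every vertex of the graph, including those in $D$, has a neighbour in $D$; in particular, the empty set is a total dominating set of the graph without vertices. Then $\mathcal{G}_E^{**}(G)$ has no total dominating set if and only if the following two conditions hold: 1. $G$ is a non-cyclic $2$-group; 2. $G$ has an element of order $2$ that is contained in no proper cyclic subgroup of $G$ of order $2^k$ with $k \ge 2$. Moreover, if $G$ is a non-cyclic $2$-group, then every element as in (2) is an isolated vertex of $\mathcal{G}_E^{**}(G)$. -/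

import Mathlib

/-- The enhanced power graph of a group: the vertices are the group elements, and two distinct
elements are adjacent iff both lie in one cyclic subgroup `⟨w⟩`. -/
def enhancedPowerGraph (G : Type*) [Group G] : SimpleGraph G where
  Adj x y := x ≠ y ∧ ∃ w : G, x ∈ Subgroup.zpowers w ∧ y ∈ Subgroup.zpowers w
  symm := ⟨fun _ _ h => ⟨h.1.symm, h.2.imp fun _ hw => ⟨hw.2, hw.1⟩⟩⟩
  loopless := ⟨fun _ h => h.1 rfl⟩

/-- The vertices of the proper enhanced power graph: the elements that are not dominating
vertices of the enhanced power graph, a dominating vertex being one that is adjacent to every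
other vertex. -/
def properVertices (G : Type*) [Group G] : Set G :=
  (enhancedPowerGraph G).universalVertsᶜ

/-- The proper enhanced power graph: the enhanced power graph with all its dominating vertices
deleted. -/
def properEnhancedPowerGraph (G : Type*) [Group G] : SimpleGraph (properVertices G) :=
  (enhancedPowerGraph G).induce (properVertices G)

/-- A total (or strong) dominating set: every vertex of the graph, in `D` or not, has a neighbour
in `D`. -/
def IsTotalDominatingSet {V : Type*} (Γ : SimpleGraph V) (D : Set V) : Prop :=
  ∀ u : V, ∃ v ∈ D, Γ.Adj u v

/-- `a` has order `2` and lies in no proper cyclic subgroup of order `2 ^ k` with `k ≥ 2`. -/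
def IsCyclicallyIsolatedInvolution {G : Type*} [Group G] (a : G) : Prop :=
  orderOf a = 2 ∧
    ∀ H : Subgroup G, H ≠ ⊤ → IsCyclic H → ∀ k : ℕ, 2 ≤ k → Nat.card H = 2 ^ k → a ∉ H

/-! A total dominating set exists iff no vertex is isolated. An isolated vertex `a` lies in `⟨w⟩`
only for `w = a`. Hence `a⁻¹ = a`, and `a` is an involution. An element `b` of odd prime order would
commute with `a` by nilpotency, putting `a` in `⟨ab⟩`; so `G` is a `2`-group. Conversely, in a
non-cyclic `2`-group every `⟨w⟩` is proper of order `2 ^ k`, so condition 2 leaves `⟨a⟩` as the only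
cyclic subgroup through `a`. -/

theorem mem_properVertices_iff {G : Type*} [Group G] {a : G} :
    a ∈ properVertices G ↔
      ∃ y, a ≠ y ∧ ∀ w : G, a ∈ Subgroup.zpowers w → y ∉ Subgroup.zpowers w := by
  have h : a ∈ properVertices G ↔ ¬ ∀ ⦃y⦄, a ≠ y → (enhancedPowerGraph G).Adj a y := Iff.rfl
  rw [h]
  constructor
  · intro h
    push Not at h
    obtain ⟨y, hay, hy⟩ := h
    exact ⟨y, hay, fun w ha hyw => hy ⟨hay, w, ha, hyw⟩⟩
  · rintro ⟨y, hay, hy⟩ h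
    obtain ⟨-, w, ha, hyw⟩ := h hay
    exact hy w ha hyw

/-- An element whose cyclic subgroup contains a non-dominating vertex is itself non-dominating. -/
theorem mem_properVertices_of_mem_zpowers {G : Type*} [Group G] {a w : G}
    (ha : a ∈ properVertices G) (haw : a ∈ Subgroup.zpowers w) : w ∈ properVertices G := by
  obtain ⟨y, -, hy⟩ := mem_properVertices_iff.1 ha
  -- A cyclic subgroup containing `w` also contains `a`, so the witness `y` for `a` serves for `w`.
  refine mem_properVertices_iff.2 ⟨y, ?_, fun v hwv => hy v (Subgroup.zpowers_le.2 hwv haw)⟩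
  rintro rfl
  exact hy w haw (Subgroup.mem_zpowers w)

theorem one_notMem_properVertices (G : Type*) [Group G] : (1 : G) ∉ properVertices G := fun h => by
  obtain ⟨y, -, hy⟩ := mem_properVertices_iff.1 h
  exact hy y (one_mem _) (Subgroup.mem_zpowers y)

theorem not_isCyclic_of_mem_properVertices {G : Type*} [Group G] {a : G}
    (ha : a ∈ properVertices G) : ¬ IsCyclic G := by
  rintro ⟨g, hg⟩
  obtain ⟨y, -, hy⟩ := mem_properVertices_iff.1 ha
  exact hy g (hg a) (hg y)

/-- An isolated vertex of the proper enhanced power graph lies in no cyclic subgroup with another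
generator. -/
theorem eq_of_isIsolated_of_mem_zpowers {G : Type*} [Group G] {a : G} {ha : a ∈ properVertices G}
    (h : (properEnhancedPowerGraph G).IsIsolated ⟨a, ha⟩) {w : G}
    (haw : a ∈ Subgroup.zpowers w) : w = a := by
  by_contra hne
  exact h ⟨w, mem_properVertices_of_mem_zpowers ha haw⟩
    ⟨Ne.symm hne, w, haw, Subgroup.mem_zpowers w⟩

theorem orderOf_eq_two_of_isIsolated {G : Type*} [Group G] {a : G} {ha : a ∈ properVertices G}
    (h : (properEnhancedPowerGraph G).IsIsolated ⟨a, ha⟩) : orderOf a = 2 := by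
  have h1 : a⁻¹ = a := eq_of_isIsolated_of_mem_zpowers h (by simp)
  refine orderOf_eq_prime ?_ fun h1 => one_notMem_properVertices G (h1 ▸ ha)
  rw [pow_two]
  nth_rewrite 1 [← h1]
  exact inv_mul_cancel a

/-- Elements of distinct prime orders in a finite nilpotent group commute. -/
theorem commute_of_orderOf_prime_of_ne {G : Type*} [Group G] [Finite G] [Group.IsNilpotent G]
    {p q : ℕ} (hp : p.Prime) (hq : q.Prime) (hpq : p ≠ q) {a b : G}
    (ha : orderOf a = p) (hb : orderOf b = q) : Commute a b := by
  have := Fact.mk hp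
  have := Fact.mk hq
  -- Entries 0 and 3 of the list: nilpotency, and normality of all Sylow subgroups.
  have hn : ∀ (p : ℕ) (_ : Fact p.Prime) (P : Sylow p G), (P : Subgroup G).Normal :=
    ((Group.isNilpotent_of_finite_tfae (G := G)).out 0 3).1 ‹Group.IsNilpotent G›
  have hpa : IsPGroup p (Subgroup.zpowers a) :=
    IsPGroup.of_card (n := 1) (by rw [Nat.card_zpowers, ha, pow_one])
  have hqb : IsPGroup q (Subgroup.zpowers b) :=
    IsPGroup.of_card (n := 1) (by rw [Nat.card_zpowers, hb, pow_one])
  obtain ⟨P, hP⟩ := hpa.exists_le_sylow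
  obtain ⟨Q, hQ⟩ := hqb.exists_le_sylow
  exact Subgroup.commute_of_normal_of_disjoint _ _ (hn p ‹_› P) (hn q ‹_› Q)
    (IsPGroup.disjoint_of_ne p q hpq _ _ P.isPGroup' Q.isPGroup') a b
    (hP (Subgroup.mem_zpowers a)) (hQ (Subgroup.mem_zpowers b))

theorem isPGroup_two_of_isIsolated {G : Type*} [Group G] [Finite G] [Group.IsNilpotent G] {a : G}
    {ha : a ∈ properVertices G} (h : (properEnhancedPowerGraph G).IsIsolated ⟨a, ha⟩) :
    IsPGroup 2 G := by
  have h2 := orderOf_eq_two_of_isIsolated h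
  refine IsPGroup.of_card (n := (Nat.card G).primeFactorsList.length)
    (Nat.eq_prime_pow_of_unique_prime_dvd Nat.card_pos.ne' fun {p} hp hdvd => ?_)
  by_contra hne
  have := Fact.mk hp
  obtain ⟨b, hb⟩ := exists_prime_orderOf_dvd_card' p hdvd
  have hab : Commute a b := commute_of_orderOf_prime_of_ne Nat.prime_two hp (Ne.symm hne) h2 hb
  -- As `p` is odd, `a ^ p = a`, while `b ^ p = 1`.
  have hpow : (a * b) ^ p = a := by
    obtain ⟨k, hk⟩ := hp.odd_of_ne_two hne
    have hbp : b ^ p = 1 := hb ▸ pow_orderOf_eq_one b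
    have ha2 : a ^ 2 = 1 := h2 ▸ pow_orderOf_eq_one a
    rw [hab.mul_pow, hbp, mul_one, hk, pow_succ, pow_mul, ha2, one_pow, one_mul]
  have hmul := eq_of_isIsolated_of_mem_zpowers h (w := a * b) ⟨p, by simpa using hpow⟩
  rw [mul_eq_left] at hmul
  rw [hmul, orderOf_one] at hb
  exact hp.one_lt.ne hb

theorem isCyclicallyIsolatedInvolution_of_isIsolated {G : Type*} [Group G] {a : G}
    {ha : a ∈ properVertices G} (h : (properEnhancedPowerGraph G).IsIsolated ⟨a, ha⟩) :
    IsCyclicallyIsolatedInvolution a := by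
  have h2 := orderOf_eq_two_of_isIsolated h
  refine ⟨h2, fun H _ hH k hk hcard haH => ?_⟩
  obtain ⟨w, rfl⟩ := (Subgroup.isCyclic_iff_exists_zpowers_eq_top H).1 hH
  rw [eq_of_isIsolated_of_mem_zpowers h haH, Nat.card_zpowers, h2] at hcard
  have := Nat.pow_right_injective le_rfl ((pow_one 2).trans hcard)
  omega

/-- In a non-cyclic `2`-group, the only cyclic subgroup containing a cyclically isolated
involution `a` is `{1, a}`. -/
theorem IsCyclicallyIsolatedInvolution.eq_one_or_eq {G : Type*} [Group G] [Finite G]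
    (hG : IsPGroup 2 G) (hc : ¬ IsCyclic G) {a : G} (ha : IsCyclicallyIsolatedInvolution a)
    {w y : G} (haw : a ∈ Subgroup.zpowers w) (hyw : y ∈ Subgroup.zpowers w) : y = 1 ∨ y = a := by
  obtain ⟨k, hk⟩ := IsPGroup.iff_orderOf.1 hG w
  have htop : Subgroup.zpowers w ≠ ⊤ := fun h => hc (isCyclic_iff_exists_zpowers_eq_top.2 ⟨w, h⟩)
  have hk2 : k < 2 := by
    by_contra hk2
    exact ha.2 _ htop inferInstance k (not_lt.1 hk2) (by rw [Nat.card_zpowers, hk]) haw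
  have hle : Nat.card (Subgroup.zpowers w) ≤ Nat.card (Subgroup.zpowers a) := by
    rw [Nat.card_zpowers, Nat.card_zpowers, hk, ha.1]
    exact (Nat.pow_le_pow_right two_pos (Nat.le_of_lt_succ hk2)).trans_eq (pow_one 2)
  rw [← Subgroup.eq_of_le_of_card_ge (Subgroup.zpowers_le.2 haw) hle] at hyw
  classical
  rw [mem_zpowers_iff_mem_range_orderOf, ha.1] at hyw
  obtain ⟨n, hn, rfl⟩ := Finset.mem_image.1 hyw
  have hn2 := Finset.mem_range.1 hn
  interval_cases n <;> simp

theorem IsCyclicallyIsolatedInvolution.exists_isIsolated {G : Type*} [Group G] [Finite G]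
    (hG : IsPGroup 2 G) (hc : ¬ IsCyclic G) {a : G} (ha : IsCyclicallyIsolatedInvolution a) :
    ∃ h : a ∈ properVertices G, (properEnhancedPowerGraph G).IsIsolated ⟨a, h⟩ := by
  have hmem : a ∈ properVertices G := by
    -- If `a` were dominating, every `y` would share a cyclic subgroup with `a`, forcing `G = ⟨a⟩`.
    by_contra hdom
    rw [mem_properVertices_iff] at hdom
    push Not at hdom
    refine hc (isCyclic_iff_exists_zpowers_eq_top.2 ⟨a, (Subgroup.eq_top_iff' _).2 fun y => ?_⟩)
    by_cases hay : a = y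
    · exact hay ▸ Subgroup.mem_zpowers a
    · obtain ⟨w, haw, hyw⟩ := hdom y hay
      rcases ha.eq_one_or_eq hG hc haw hyw with rfl | rfl
      · exact one_mem _
      · exact Subgroup.mem_zpowers _
  refine ⟨hmem, ?_⟩
  rintro ⟨y, hy⟩ ⟨hne, w, haw, hyw⟩
  rcases ha.eq_one_or_eq hG hc haw hyw with h1 | h1
  · exact one_notMem_properVertices G (h1 ▸ hy)
  · exact hne h1.symm

theorem not_exists_isTotalDominatingSet_iff {V : Type*} (Γ : SimpleGraph V) :
    (¬ ∃ D : Set V, IsTotalDominatingSet Γ D) ↔ ∃ v, Γ.IsIsolated v := by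
  constructor
  · intro h
    by_contra! hv
    -- Enlarging `D` only helps, so the full vertex set is the one to test.
    refine h ⟨Set.univ, fun u => ?_⟩
    by_contra! hu
    exact hv u fun v => hu v (Set.mem_univ v)
  · rintro ⟨v, hv⟩ ⟨D, hD⟩
    obtain ⟨u, -, hu⟩ := hD v
    exact hv u hu

theorem mainTheorem1 (G : Type*) [Group G] [Finite G] [Group.IsNilpotent G] :
    ((¬ ∃ D : Set (properVertices G), IsTotalDominatingSet (properEnhancedPowerGraph G) D) ↔
      (IsPGroup 2 G ∧ ¬ IsCyclic G) ∧ ∃ a : G, IsCyclicallyIsolatedInvolution a) ∧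
    (IsPGroup 2 G → ¬ IsCyclic G → ∀ a : G, IsCyclicallyIsolatedInvolution a →
      ∃ ha : a ∈ properVertices G, (properEnhancedPowerGraph G).IsIsolated ⟨a, ha⟩) := by
  refine ⟨?_, fun hG hc a ha => ha.exists_isIsolated hG hc⟩
  rw [not_exists_isTotalDominatingSet_iff]
  constructor
  · rintro ⟨⟨a, ha⟩, h⟩
    exact ⟨⟨isPGroup_two_of_isIsolated h, not_isCyclic_of_mem_properVertices ha⟩, a,
      isCyclicallyIsolatedInvolution_of_isIsolated h⟩
  · rintro ⟨⟨hG, hc⟩, a, ha⟩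
    obtain ⟨hmem, h⟩ := ha.exists_isIsolated hG hc
    exact ⟨⟨a, hmem⟩, h⟩
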